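/- Let $n_1,n_2,n_f,m\ge 0$ be integers. Let $M_{11}\in\mathbb{R}^{n_1\times n_1}$, $R\in\mathbb{R}^{m\times m}$ and $M_\nu\in\mathbb{R}^{n_f\times n_f}$ be symmetric positive definite matrices, let $C_1\in\mathbb{R}^{n_f\times n_1}$, $C_2\in\mathbb{R}^{n_f\times n_2}$ and $\Upsilon\in\mathbb{R}^{n_f\times m}$ be arbitrary, and let $\hat Y\in\mathbb{R}^{n_2\times r}$ be a matrix whose columns form a basis of $\operatorname{im}(C_2^T)$. Put $n_r=n_1+r$ and $$ F_\sigma=\begin{bmatrix} I & C_1^T\Upsilon\\ 0 & \hat Y^TC_2^T\Upsilon\end{bmatrix},\quad M_\sigma=\begin{bmatrix} M_{11}&0\\0&R^{-1}\end{bmatrix},\quad F_\nu=\begin{bmatrix} C_1^T\\ \hat Y^TC_2^T\end{bmatrix}, $$ $$ E_r=F_\sigma M_\sigma F_\sigma^T,\qquad A_r=-F_\nu M_\nu F_\nu^T,\qquad B_r=F_\nu\Upsilon R^{-1}. $$ (These are the matrices of the regularized finite element discretization of the magneto-quasistatic equations.) Let the columns of $Y_\sigma$, $Y_\nu$ and $W_1$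 be arbitrary bases of $\ker(F_\sigma^T)$, $\ker(F_\nu^T)$ and $\ker\bigl([E_rY_\nu,\;A_rY_\sigma]^T\bigr)$, respectively, let $$ W=\bigl[\,W_1,\;\; Y_\nu(Y_\nu^TE_rY_\nu)^{-1/2},\;\; Y_\sigma(-Y_\sigma^TA_rY_\sigma)^{-1/2}\,\bigr],\qquad E_{11}=W_1^TE_rW_1, $$ and define the reflexive inverse of $E_r$ and the output matrix by $$ E_r^-=W\begin{bmatrix}E_{11}^{-1}&&\\&I&\\&&0\end{bmatrix}W^T,\qquad C_r=-B_r^TE_r^-A_r . $$ Then the system $E_r\dot x=A_rx+B_ru$, $y=C_rx$ is passive: for every $t_f>0$, every input $u\in L_2(0,t_f)$ with values in $\mathbb{R}^m$, and every $x:[0,t_f]\to\mathbb{R}^{n_r}$ such that $E_rx$ is absolutely continuous on $[0,t_f]$, $\frac{d}{dt}(E_rx)=A_rx+B_ru$ almost everywhere on $(0,t_f)$ and $E_rx(0)=0$, the function $y^Tu$ with $y=C_rx$ is integrable on $(0,t_f)$ and $$\int_0^{t_f}y(t)^Tu(t)\,dt\ge 0 .$$ Moreover, $sE_r-A_r$ is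 nonsingular for every $s\in\mathbb{C}$ with $\operatorname{Re}(s)>0$, and the transfer function $H_r(s)=C_r(sE_r-A_r)^{-1}B_r$ is positive real: it is analytic on $\mathbb{C}_+=\{s:\operatorname{Re}(s)>0\}$, and $H_r(s)+H_r(s)^*$ is positive semidefinite for all $s\in\mathbb{C}_+$. -/

import Mathlib

/-! Regularised semidiscretised magneto-quasistatic (MQS) systems, the reflexive inverse of their
descriptor matrix, and passivity of linear descriptor systems. -/

namespace MQS

section LinearAlgebra

open Matrix

/-- The columns of `Y` form a basis of the subspace `S`. -/
def IsBasisMatrix {ι κ : Type*} (Y : Matrix ι κ ℝ) (S : Submodule ℝ (ι → ℝ)) : Prop :=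
  LinearIndependent ℝ Y.col ∧ Submodule.span ℝ (Set.range Y.col) = S

/-- The kernel of a real matrix. -/
def matKer {ι κ : Type*} [Fintype κ] (P : Matrix ι κ ℝ) : Submodule ℝ (κ → ℝ) :=
  LinearMap.ker P.mulVecLin

/-- The image of a real matrix. -/
def matIm {ι κ : Type*} [Fintype κ] (P : Matrix ι κ ℝ) : Submodule ℝ (ι → ℝ) :=
  LinearMap.range P.mulVecLin

end LinearAlgebra

section DescriptorSystems

open Matrix MeasureTheory
open scoped ComplexOrder

variable {n m : Type*} [Fintype n] [Fintype m]

/-- `x` solves `E ẋ = A x + B u` on `[0, tf]`: the function `E x` is absolutely continuous and the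
equation `(E x)' = A x + B u` holds almost everywhere. -/
structure IsSolution (E A : Matrix n n ℝ) (B : Matrix n m ℝ) (tf : ℝ)
    (u : ℝ → m → ℝ) (x : ℝ → n → ℝ) : Prop where
  absolutelyContinuous : AbsolutelyContinuousOnInterval (fun t => E *ᵥ x t) 0 tf
  equation : ∀ᵐ t ∂(volume.restrict (Set.Ioo 0 tf)),
    HasDerivAt (fun τ => E *ᵥ x τ) (A *ᵥ x t + B *ᵥ u t) t

/-- Passivity of `E ẋ = A x + B u`, `y = C x`: for every `tf > 0`, every input `u ∈ L₂(0, tf)` and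
every solution `x` belonging to it with `E x(0) = 0`, the function `yᵀ u` is integrable over
`(0, tf)` and its integral is nonnegative. -/
def IsPassive (E A : Matrix n n ℝ) (B : Matrix n m ℝ) (C : Matrix m n ℝ) : Prop :=
  ∀ tf : ℝ, 0 < tf → ∀ u : ℝ → m → ℝ, MemLp u 2 (volume.restrict (Set.Ioo 0 tf)) →
    ∀ x : ℝ → n → ℝ, IsSolution E A B tf u x → E *ᵥ x 0 = 0 →
      IntervalIntegrable (fun t => (C *ᵥ x t) ⬝ᵥ u t) volume 0 tf ∧
        0 ≤ ∫ t in (0 : ℝ)..tf, (C *ᵥ x t) ⬝ᵥ u t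

/-- The pencil `s E - A` at the complex number `s`. -/
noncomputable def pencil (E A : Matrix n n ℝ) (s : ℂ) : Matrix n n ℂ :=
  s • E.map Complex.ofReal - A.map Complex.ofReal

/-- The transfer function `H(s) = C (s E - A)⁻¹ B`. -/
noncomputable def transferFunction [DecidableEq n] (E A : Matrix n n ℝ) (B : Matrix n m ℝ)
    (C : Matrix m n ℝ) (s : ℂ) : Matrix m m ℂ :=
  C.map Complex.ofReal * (pencil E A s)⁻¹ * B.map Complex.ofReal

/-- Positive realness: `H` is analytic in the open right half-plane, and `H(s) + H(s)ᴴ` is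
positive semidefinite there. -/
def IsPositiveReal (H : ℂ → Matrix m m ℂ) : Prop :=
  (∀ i j, AnalyticOnNhd ℂ (fun s => H s i j) {s : ℂ | 0 < s.re}) ∧
    ∀ s : ℂ, 0 < s.re → (H s + (H s)ᴴ).PosSemidef

end DescriptorSystems

section ReflexiveInverse

open Matrix
open scoped MatrixOrder

variable {n s z q : Type*} [Fintype n] [Fintype s] [Fintype z] [Fintype q]
  [DecidableEq s] [DecidableEq z] [DecidableEq q]

/-- The inverse square root `S^{-1/2}` of a symmetric positive definite matrix. -/
noncomputable def invSqrt {k : Type*} [Fintype k] [DecidableEq k] (S : Matrix k k ℝ) :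
    Matrix k k ℝ :=
  (CFC.sqrt S)⁻¹

/-- The matrix
`W = [W₁, Y_ν (Y_νᵀ E Y_ν)^{-1/2}, Y_σ (-Y_σᵀ A Y_σ)^{-1/2}]`
which transforms the pencil `λ E - A` into quasi-Weierstrass form. -/
noncomputable def weierstrassMatrix (E A : Matrix n n ℝ) (W₁ : Matrix n s ℝ) (Yν : Matrix n z ℝ)
    (Yσ : Matrix n q ℝ) : Matrix n (s ⊕ z ⊕ q) ℝ :=
  fromCols W₁ (fromCols (Yν * invSqrt (Yνᵀ * E * Yν)) (Yσ * invSqrt (-(Yσᵀ * A * Yσ))))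

/-- The reflexive inverse `E⁻ = W diag(E₁₁⁻¹, I, 0) Wᵀ` of `E`, where `E₁₁ = W₁ᵀ E W₁`. -/
noncomputable def reflexiveInverse (E A : Matrix n n ℝ) (W₁ : Matrix n s ℝ) (Yν : Matrix n z ℝ)
    (Yσ : Matrix n q ℝ) : Matrix n n ℝ :=
  weierstrassMatrix E A W₁ Yν Yσ *
    (fromBlocks (W₁ᵀ * E * W₁)⁻¹ 0 0 (fromBlocks 1 0 0 0) :
      Matrix (s ⊕ z ⊕ q) (s ⊕ z ⊕ q) ℝ) *
      (weierstrassMatrix E A W₁ Yν Yσ)ᵀ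

end ReflexiveInverse

section System

open Matrix

/-- The matrices that enter the regularised MQS system. The index types `n₁`, `n₂`, `f`, `m`
number the conducting edges, the non-conducting edges, the faces and the terminals;
`r` numbers the columns of the matrix `Y` (a basis matrix of `im C₂ᵀ`). -/
structure Data (n₁ n₂ f m r : Type*) where
  /-- conductivity matrix of the conducting part -/
  M₁₁ : Matrix n₁ n₁ ℝ
  /-- resistance matrix -/
  R : Matrix m m ℝ
  /-- reluctivity matrix -/
  Mν : Matrix f f ℝ
  /-- conducting part of the discrete curl matrix -/
  C₁ : Matrix f n₁ ℝ
  /-- non-conducting part of the discrete curl matrix -/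
  C₂ : Matrix f n₂ ℝ
  /-- factor `Υ` of the coupling matrix `X = Cᵀ Υ` -/
  Υ : Matrix f m ℝ
  /-- basis matrix of the image of `C₂ᵀ` -/
  Y : Matrix n₂ r ℝ

variable {n₁ n₂ f m r : Type*} [Fintype n₁] [Fintype n₂] [Fintype f] [Fintype m]
  [DecidableEq n₁] [DecidableEq m]

/-- `F_σ = [[I, C₁ᵀ Υ], [0, Yᵀ C₂ᵀ Υ]]`. -/
def Data.Fσ (D : Data n₁ n₂ f m r) : Matrix (n₁ ⊕ r) (n₁ ⊕ m) ℝ :=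
  fromBlocks 1 (D.C₁ᵀ * D.Υ) 0 (D.Yᵀ * D.C₂ᵀ * D.Υ)

/-- `M_σ = diag(M₁₁, R⁻¹)`. -/
noncomputable def Data.Mσ (D : Data n₁ n₂ f m r) : Matrix (n₁ ⊕ m) (n₁ ⊕ m) ℝ :=
  fromBlocks D.M₁₁ 0 0 D.R⁻¹

/-- `F_ν = [C₁ᵀ; Yᵀ C₂ᵀ]`. -/
def Data.Fν (D : Data n₁ n₂ f m r) : Matrix (n₁ ⊕ r) f ℝ :=
  fromRows D.C₁ᵀ (D.Yᵀ * D.C₂ᵀ)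

/-- `E_r = F_σ M_σ F_σᵀ`. -/
noncomputable def Data.Er (D : Data n₁ n₂ f m r) : Matrix (n₁ ⊕ r) (n₁ ⊕ r) ℝ :=
  D.Fσ * D.Mσ * D.Fσᵀ

/-- `A_r = -F_ν M_ν F_νᵀ`. -/
def Data.Ar (D : Data n₁ n₂ f m r) : Matrix (n₁ ⊕ r) (n₁ ⊕ r) ℝ :=
  -(D.Fν * D.Mν * D.Fνᵀ)

/-- `B_r = F_ν Υ R⁻¹`. -/
noncomputable def Data.Br (D : Data n₁ n₂ f m r) : Matrix (n₁ ⊕ r) m ℝ :=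
  D.Fν * D.Υ * D.R⁻¹

variable [Fintype r]
variable {s z q : Type*} [Fintype s] [Fintype z] [Fintype q]
  [DecidableEq s] [DecidableEq z] [DecidableEq q]

/-- `C_r = -B_rᵀ E_r⁻ A_r`. -/
noncomputable def Data.Cr (D : Data n₁ n₂ f m r) (W₁ : Matrix (n₁ ⊕ r) s ℝ)
    (Yν : Matrix (n₁ ⊕ r) z ℝ) (Yσ : Matrix (n₁ ⊕ r) q ℝ) : Matrix m (n₁ ⊕ r) ℝ :=
  -(D.Brᵀ * reflexiveInverse D.Er D.Ar W₁ Yν Yσ * D.Ar)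

end System

end MQS

namespace MQS

/-! ### Kernels, congruences and the reflexive inverse. -/

section Algebra

open Matrix
open scoped MatrixOrder

variable {n k l : Type*}

/-! Write `E`, `A` for the system matrices and `G` for the reflexive inverse. Both `E` and `-A` are
positive semidefinite with kernels meeting only in zero, and three identities carry everything: `Gᵀ
= G`, `G E G = G`, `A G E = E G A` (`isCompatibleInverse_reflexiveInverse`).

Passivity: with `K = G A G` the identities give `G A = K E`, so the output is `-Bᵀ K E x`. The
storage function `V = -½ (E x)ᵀ K (E x) = ½ (G E x)ᵀ (-A) (G E x)` is nonnegative, and along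
solutions `V' = yᵀ u - (K E x)ᵀ E (K E x) ≤ yᵀ u`. Integrating from `V(0) = 0` gives the inequality.

Positive realness: with `N = (p E - A)⁻¹ B`, the transfer function is `Nᴴ (p̄ (-E G A) + A G A) N`,
where `-E G A = (E G) (-A) (E G)ᵀ` and `A G A = (A G) E (A G)ᵀ` are positive semidefinite. -/

theorem IsBasisMatrix.mulVec_eq_zero [Fintype k] {Y : Matrix n k ℝ} {S : Submodule ℝ (n → ℝ)}
    (h : IsBasisMatrix Y S) {v : k → ℝ} (hv : Y *ᵥ v = 0) : v = 0 :=
  Matrix.mulVec_injective_iff.mpr h.1 (by rw [hv, mulVec_zero])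

theorem IsBasisMatrix.mem_iff [Fintype k] {Y : Matrix n k ℝ} {S : Submodule ℝ (n → ℝ)}
    (h : IsBasisMatrix Y S) {x : n → ℝ} : x ∈ S ↔ ∃ v, Y *ᵥ v = x := by
  rw [← h.2, ← Matrix.range_mulVecLin]
  simp

theorem mem_matKer [Fintype n] {P : Matrix l n ℝ} {x : n → ℝ} : x ∈ matKer P ↔ P *ᵥ x = 0 := by
  simp [matKer]

variable [Fintype n] [Fintype k]

theorem IsBasisMatrix.mul_eq_zero {Y : Matrix n k ℝ} {P : Matrix l n ℝ}
    (h : IsBasisMatrix Y (matKer P)) : P * Y = 0 := by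
  classical
  refine Matrix.ext_of_mulVec_single fun i => ?_
  rw [← mulVec_mulVec, zero_mulVec]
  exact mem_matKer.mp (h.mem_iff.mpr ⟨_, rfl⟩)

theorem IsBasisMatrix.exists_eq_mul {Y : Matrix n k ℝ} {P : Matrix l n ℝ}
    (h : IsBasisMatrix Y (matKer P)) {Q : Matrix n n ℝ} (hQ : P * Q = 0) :
    ∃ c : Matrix k n ℝ, Q = Y * c := by
  have key : ∀ j, ∃ v, Y *ᵥ v = Q.col j := fun j => by
    rw [← h.mem_iff, mem_matKer]
    exact congrFun (congrArg Matrix.col hQ) j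
  choose v hv using key
  refine ⟨(Matrix.of v)ᵀ, ?_⟩
  ext i j
  exact (congrFun (hv j) i).symm

/-- A congruence `F M Fᵀ` with `M` positive definite has the kernel of `Fᵀ`. -/
theorem matKer_mul_mul_transpose {F : Matrix n k ℝ} {M : Matrix k k ℝ} (hM : M.PosDef) :
    matKer (F * M * Fᵀ) = matKer Fᵀ := by
  ext x
  rw [mem_matKer, mem_matKer]
  constructor
  · intro h
    by_contra hx
    have h1 := hM.dotProduct_mulVec_pos hx
    have h2 : x ⬝ᵥ ((F * M * Fᵀ) *ᵥ x) = (Fᵀ *ᵥ x) ⬝ᵥ (M *ᵥ (Fᵀ *ᵥ x)) := by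
      rw [← mulVec_mulVec, ← mulVec_mulVec, dotProduct_mulVec x F, mulVec_transpose]
    rw [h, dotProduct_zero] at h2
    rw [star_trivial, ← h2] at h1
    exact lt_irrefl _ h1
  · intro h
    rw [← mulVec_mulVec, h, mulVec_zero]

theorem _root_.Matrix.PosSemidef.posDef_transpose_mul_mul {P : Matrix n n ℝ} (hP : P.PosSemidef)
    {Y : Matrix n k ℝ} (h : ∀ v, P *ᵥ (Y *ᵥ v) = 0 → v = 0) : (Yᵀ * P * Y).PosDef := by
  have hpsd : (Yᵀ * P * Y).PosSemidef := by
    simpa [conjTranspose_eq_transpose_of_trivial] using hP.conjTranspose_mul_mul_same Y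
  refine .of_dotProduct_mulVec_pos hpsd.isHermitian fun v hv => ?_
  refine lt_of_le_of_ne (hpsd.dotProduct_mulVec_nonneg v) fun h0 => hv (h v ?_)
  rw [← hP.dotProduct_mulVec_zero_iff, h0]
  rw [← mulVec_mulVec, ← mulVec_mulVec, dotProduct_mulVec _ Yᵀ, vecMul_transpose, star_trivial,
    star_trivial]

theorem invSqrt_mul_transpose [DecidableEq k] {S : Matrix k k ℝ} (hS : S.PosDef) :
    invSqrt S * (invSqrt S)ᵀ = S⁻¹ := by
  have hsym : (CFC.sqrt S)ᵀ = CFC.sqrt S := by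
    have := (CFC.sqrt_nonneg S).posSemidef.isHermitian
    rwa [IsHermitian, conjTranspose_eq_transpose_of_trivial] at this
  rw [invSqrt, transpose_nonsing_inv, hsym, ← Matrix.mul_inv_rev,
    CFC.sqrt_mul_sqrt_self S hS.posSemidef.nonneg]

theorem transpose_fromCols_mul_mul {s z q : Type*} {E A : Matrix n n ℝ} (hE : Eᵀ = E) (hA : Aᵀ = A)
    (Yν : Matrix n z ℝ) (Yσ : Matrix n q ℝ) (Q : Matrix n s ℝ) :
    (fromCols (E * Yν) (A * Yσ))ᵀ * Q = fromRows (Yνᵀ * E * Q) (Yσᵀ * A * Q) := by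
  rw [transpose_fromCols, transpose_mul, transpose_mul, hE, hA, fromRows_mul]

variable {s z q : Type*} [Fintype s] [Fintype z] [Fintype q]
  [DecidableEq s] [DecidableEq z] [DecidableEq q]

/-- The zero block removes `Yσ`, and the square roots enter only through the product that equals
`(Yνᵀ E Yν)⁻¹`. -/
theorem reflexiveInverse_eq {E A : Matrix n n ℝ} {W₁ : Matrix n s ℝ} {Yν : Matrix n z ℝ}
    {Yσ : Matrix n q ℝ} (hS : (Yνᵀ * E * Yν).PosDef) :
    reflexiveInverse E A W₁ Yν Yσ =
      W₁ * (W₁ᵀ * E * W₁)⁻¹ * W₁ᵀ + Yν * (Yνᵀ * E * Yν)⁻¹ * Yνᵀ := by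
  rw [← invSqrt_mul_transpose hS]
  simp [reflexiveInverse, weierstrassMatrix, transpose_fromCols, fromCols_mul_fromBlocks,
    fromCols_mul_fromRows, transpose_mul, Matrix.mul_assoc]

/-- The algebraic properties of the reflexive inverse `G` of `E` which passivity rests on. -/
structure IsCompatibleInverse (E A G : Matrix n n ℝ) : Prop where
  transpose_eq : Gᵀ = G
  mul_mul_self : G * E * G = G
  mul_mul_comm : A * G * E = E * G * A

/-- The spans of `W₁`, `Yν` and `Yσ` are mutually orthogonal for the forms of both `E` and `A`.
Subtracting the `Yν` and `Yσ` components of the identity leaves a matrix `W₁ c`, which turns `A G E`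
into a visibly symmetric expression. -/
theorem isCompatibleInverse_reflexiveInverse [DecidableEq n] {E A : Matrix n n ℝ}
    (hE : E.PosSemidef)
    (hA : (-A).PosSemidef) (hEA : ∀ v, E *ᵥ v = 0 → A *ᵥ v = 0 → v = 0)
    {W₁ : Matrix n s ℝ} {Yν : Matrix n z ℝ} {Yσ : Matrix n q ℝ}
    (hYσ : IsBasisMatrix Yσ (matKer E)) (hYν : IsBasisMatrix Yν (matKer A))
    (hW₁ : IsBasisMatrix W₁ (matKer (fromCols (E * Yν) (A * Yσ))ᵀ)) :
    IsCompatibleInverse E A (reflexiveInverse E A W₁ Yν Yσ) := by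
  have hEt : Eᵀ = E := by
    simpa [IsHermitian, conjTranspose_eq_transpose_of_trivial] using hE.isHermitian
  have hAt : Aᵀ = A := by
    simpa [IsHermitian, conjTranspose_eq_transpose_of_trivial] using hA.isHermitian
  have hEσ : E * Yσ = 0 := hYσ.mul_eq_zero
  have hAν : A * Yν = 0 := hYν.mul_eq_zero
  have hker := transpose_fromCols_mul_mul hEt hAt Yν Yσ W₁
  rw [hW₁.mul_eq_zero] at hker
  have hνEW : Yνᵀ * E * W₁ = 0 := by
    ext i j; exact (congrFun (congrFun hker (Sum.inl i)) j).symm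
  have hσAW : Yσᵀ * A * W₁ = 0 := by
    ext i j; exact (congrFun (congrFun hker (Sum.inr i)) j).symm
  have hWEν : W₁ᵀ * E * Yν = 0 := by
    simpa [transpose_mul, hEt, Matrix.mul_assoc] using congrArg transpose hνEW
  have hS : (Yνᵀ * E * Yν).PosDef := hE.posDef_transpose_mul_mul fun v hv =>
    hYν.mulVec_eq_zero (hEA _ hv (by rw [mulVec_mulVec, hAν, zero_mulVec]))
  have hT : (Yσᵀ * (-A) * Yσ).PosDef := hA.posDef_transpose_mul_mul fun v hv =>
    hYσ.mulVec_eq_zero (hEA _ (by rw [mulVec_mulVec, hEσ, zero_mulVec])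
      (by simpa [neg_mulVec] using hv))
  -- If `E W₁ v = 0`, then `W₁ v = Yσ b`; since `Yσᵀ A W₁ = 0` and `-Yσᵀ A Yσ` is definite, `b = 0`.
  have hE₁₁ : (W₁ᵀ * E * W₁).PosDef := hE.posDef_transpose_mul_mul fun v hv => by
    obtain ⟨b, hb⟩ := hYσ.mem_iff.mp (mem_matKer.mpr hv)
    have h1 : (Yσᵀ * (-A) * Yσ) *ᵥ b = 0 := by
      rw [← mulVec_mulVec, hb, mulVec_mulVec, Matrix.mul_neg, Matrix.neg_mul, hσAW, neg_zero,
        zero_mulVec]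
    have h2 : b = 0 := by
      by_contra h
      have := hT.dotProduct_mulVec_pos h
      rw [h1, dotProduct_zero] at this
      exact lt_irrefl _ this
    rw [h2, mulVec_zero] at hb
    exact hW₁.mulVec_eq_zero hb.symm
  have uS := (isUnit_iff_isUnit_det _).mp hS.isUnit
  have uT := (isUnit_iff_isUnit_det _).mp hT.isUnit
  have uE := (isUnit_iff_isUnit_det _).mp hE₁₁.isUnit
  rw [reflexiveInverse_eq hS]
  set S := Yνᵀ * E * Yν with hSdef
  set T := Yσᵀ * (-A) * Yσ with hTdef
  set E₁₁ := W₁ᵀ * E * W₁ with hE₁₁def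
  have hSt : Sᵀ = S := by simp [hSdef, transpose_mul, hEt, Matrix.mul_assoc]
  have hTt : Tᵀ = T := by simp [hTdef, transpose_mul, hAt, Matrix.mul_assoc]
  have hE₁₁t : E₁₁ᵀ = E₁₁ := by simp [hE₁₁def, transpose_mul, hEt, Matrix.mul_assoc]
  -- the projector onto the span of `W₁`
  obtain ⟨c, hc⟩ := hW₁.exists_eq_mul
    (Q := 1 - Yν * S⁻¹ * (Yνᵀ * E) + Yσ * T⁻¹ * (Yσᵀ * A)) (by
      rw [transpose_fromCols_mul_mul hEt hAt]
      have h1 : Yνᵀ * E * (1 - Yν * S⁻¹ * (Yνᵀ * E) + Yσ * T⁻¹ * (Yσᵀ * A)) = 0 := by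
        calc _ = Yνᵀ * E - (Yνᵀ * E * Yν) * S⁻¹ * (Yνᵀ * E)
              + Yνᵀ * (E * Yσ) * T⁻¹ * (Yσᵀ * A) := by
                simp only [Matrix.mul_add, Matrix.mul_sub, Matrix.mul_one, Matrix.mul_assoc]
          _ = 0 := by rw [← hSdef, mul_nonsing_inv S uS, hEσ]; simp
      have h2 : Yσᵀ * A * (1 - Yν * S⁻¹ * (Yνᵀ * E) + Yσ * T⁻¹ * (Yσᵀ * A)) = 0 := by
        calc _ = Yσᵀ * A - Yσᵀ * (A * Yν) * S⁻¹ * (Yνᵀ * E)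
              - (Yσᵀ * (-A) * Yσ) * T⁻¹ * (Yσᵀ * A) := by
                simp only [Matrix.mul_add, Matrix.mul_sub, Matrix.mul_one, Matrix.mul_assoc,
                  Matrix.neg_mul, Matrix.mul_neg, sub_neg_eq_add]
          _ = 0 := by rw [← hTdef, mul_nonsing_inv T uT, hAν]; simp
      rw [h1, h2, fromRows_zero])
  have hWE : W₁ᵀ * E = E₁₁ * c := by
    calc W₁ᵀ * E = W₁ᵀ * E * (1 - Yν * S⁻¹ * (Yνᵀ * E) + Yσ * T⁻¹ * (Yσᵀ * A))
          + (W₁ᵀ * E * Yν) * S⁻¹ * (Yνᵀ * E) - W₁ᵀ * (E * Yσ) * T⁻¹ * (Yσᵀ * A) := by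
            simp only [Matrix.mul_add, Matrix.mul_sub, Matrix.mul_one, Matrix.mul_assoc]
            abel
      _ = E₁₁ * c := by rw [hc, hWEν, hEσ]; simp [hE₁₁def, Matrix.mul_assoc]
  have hAGE : A * (W₁ * E₁₁⁻¹ * W₁ᵀ + Yν * S⁻¹ * Yνᵀ) * E = A + A * Yσ * T⁻¹ * (Yσᵀ * A) := by
    calc _ = A * W₁ * E₁₁⁻¹ * (W₁ᵀ * E) + (A * Yν) * S⁻¹ * (Yνᵀ * E) := by
            simp only [Matrix.mul_add, Matrix.add_mul, Matrix.mul_assoc]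
      _ = A * (W₁ * c) := by
        rw [hWE, hAν, Matrix.mul_assoc _ E₁₁⁻¹, nonsing_inv_mul_cancel_left _ _ uE]
        simp [Matrix.mul_assoc]
      _ = A - (A * Yν) * S⁻¹ * (Yνᵀ * E) + A * Yσ * T⁻¹ * (Yσᵀ * A) := by
        rw [← hc]
        simp only [Matrix.mul_add, Matrix.mul_sub, Matrix.mul_one, Matrix.mul_assoc]
      _ = _ := by rw [hAν]; simp
  have hGt : (W₁ * E₁₁⁻¹ * W₁ᵀ + Yν * S⁻¹ * Yνᵀ)ᵀ = W₁ * E₁₁⁻¹ * W₁ᵀ + Yν * S⁻¹ * Yνᵀ := by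
    simp [transpose_mul, transpose_nonsing_inv, hE₁₁t, hSt, Matrix.mul_assoc]
  refine ⟨hGt, ?_, ?_⟩
  · calc _ = W₁ * (E₁₁⁻¹ * (W₁ᵀ * E * W₁)) * E₁₁⁻¹ * W₁ᵀ
          + W₁ * E₁₁⁻¹ * (W₁ᵀ * E * Yν) * S⁻¹ * Yνᵀ
          + Yν * S⁻¹ * (Yνᵀ * E * W₁) * E₁₁⁻¹ * W₁ᵀ
          + Yν * (S⁻¹ * (Yνᵀ * E * Yν)) * S⁻¹ * Yνᵀ := by
            simp only [Matrix.mul_add, Matrix.add_mul, Matrix.mul_assoc]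
            abel
      _ = _ := by
        rw [hWEν, hνEW, ← hSdef, ← hE₁₁def, nonsing_inv_mul _ uE, nonsing_inv_mul _ uS]
        simp
  -- The right side of `hAGE` is symmetric, while transposing `A G E` gives `E G A`.
  · have h := congrArg transpose hAGE
    rw [transpose_mul, transpose_mul, hGt, hEt, hAt, ← Matrix.mul_assoc] at h
    rw [h, hAGE]
    simp [transpose_mul, transpose_nonsing_inv, hTt, hAt, Matrix.mul_assoc]

end Algebra

end MQS

namespace MQS

/-! ### Absolute continuity of the storage function and the dissipation inequality. -/

section Passivity

open Matrix MeasureTheory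
open scoped ComplexOrder

variable {n m : Type*} [Fintype n] [Fintype m]

theorem _root_.AbsolutelyContinuousOnInterval.apply {f : ℝ → n → ℝ} {a b : ℝ}
    (hf : AbsolutelyContinuousOnInterval f a b) (i : n) :
    AbsolutelyContinuousOnInterval (fun t => f t i) a b := by
  refine squeeze_zero (fun t => Finset.sum_nonneg fun _ _ => dist_nonneg) (fun t => ?_) hf
  exact Finset.sum_le_sum fun j _ => dist_le_pi_dist _ _ i

theorem _root_.AbsolutelyContinuousOnInterval.fun_sum {ι : Type*} (s : Finset ι) {f : ι → ℝ → ℝ}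
    {a b : ℝ} (hf : ∀ i ∈ s, AbsolutelyContinuousOnInterval (f i) a b) :
    AbsolutelyContinuousOnInterval (fun t => ∑ i ∈ s, f i t) a b := by
  classical
  induction s using Finset.induction_on with
  | empty => simpa [AbsolutelyContinuousOnInterval] using tendsto_const_nhds
  | insert i s hi ih =>
    simp_rw [Finset.sum_insert hi]
    exact (hf i (Finset.mem_insert_self i s)).fun_add
      (ih fun j hj => hf j (Finset.mem_insert_of_mem hj))

theorem _root_.AbsolutelyContinuousOnInterval.quadraticForm (K : Matrix n n ℝ) {w : ℝ → n → ℝ}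
    {a b : ℝ} (hw : AbsolutelyContinuousOnInterval w a b) :
    AbsolutelyContinuousOnInterval (fun t => w t ⬝ᵥ (K *ᵥ w t)) a b := by
  simp only [dotProduct, mulVec]
  exact .fun_sum _ fun i _ => (hw.apply i).fun_mul
    (.fun_sum _ fun j _ => (hw.apply j).const_mul (K i j))

theorem hasDerivAt_quadraticForm {K : Matrix n n ℝ} (hK : Kᵀ = K) {w : ℝ → n → ℝ} {w' : n → ℝ}
    {t : ℝ} (hw : HasDerivAt w w' t) :
    HasDerivAt (fun τ => w τ ⬝ᵥ (K *ᵥ w τ)) (2 * ((K *ᵥ w t) ⬝ᵥ w')) t := by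
  have hi := hasDerivAt_pi.mp hw
  have h : HasDerivAt (fun τ => ∑ i, w τ i * ∑ j, K i j * w τ j)
      (∑ i, (w' i * ∑ j, K i j * w t j + w t i * ∑ j, K i j * w' j)) t :=
    HasDerivAt.fun_sum fun i _ => (hi i).mul
      (HasDerivAt.fun_sum fun j _ => (hi j).const_mul (K i j))
  refine h.congr_deriv ?_
  rw [Finset.sum_add_distrib]
  change w' ⬝ᵥ (K *ᵥ w t) + w t ⬝ᵥ (K *ᵥ w') = _
  rw [dotProduct_mulVec (w t), ← mulVec_transpose, hK, dotProduct_comm w']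
  ring

theorem IsCompatibleInverse.isPassive {E A G : Matrix n n ℝ} (hG : IsCompatibleInverse E A G)
    (hE : E.PosSemidef) (hA : (-A).PosSemidef) (B : Matrix n m ℝ) :
    IsPassive E A B (-(Bᵀ * G * A)) := by
  intro tf htf u hu x hx hx0
  have hAt : Aᵀ = A := by
    simpa [IsHermitian, conjTranspose_eq_transpose_of_trivial] using hA.isHermitian
  have hGAG : (G * A * G)ᵀ = G * A * G := by
    simp [transpose_mul, hAt, hG.transpose_eq, Matrix.mul_assoc]
  -- `G A = G E G A`, then `E G A` is replaced by `A G E`.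
  have hGA : G * A = G * A * G * E := by
    rw [Matrix.mul_assoc G A G, Matrix.mul_assoc G, hG.mul_mul_comm, ← Matrix.mul_assoc,
      ← Matrix.mul_assoc, hG.mul_mul_self]
  set K := G * A * G with hK
  have hKA : K * A = K * E * K * E := by
    calc K * A = G * A * (G * A) := by simp [hK, Matrix.mul_assoc]
      _ = K * E * (K * E) := by rw [hGA]
      _ = _ := by simp [Matrix.mul_assoc]
  -- The output depends on `x` only through the continuous function `E x`, so no regularity of `x`
  -- itself is needed.
  have hy : ∀ t, (-(Bᵀ * G * A)) *ᵥ x t = (-(Bᵀ * K)) *ᵥ (E *ᵥ x t) := fun t => by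
    rw [mulVec_mulVec, Matrix.neg_mul, Matrix.mul_assoc, hGA, ← Matrix.mul_assoc]
  have hw := hx.absolutelyContinuous
  have hint : IntervalIntegrable (fun t => ((-(Bᵀ * G * A)) *ᵥ x t) ⬝ᵥ u t) volume 0 tf := by
    have hu1 : Integrable u (volume.restrict (Set.Ioo 0 tf)) := hu.integrable (by norm_num)
    have hui : ∀ i, IntervalIntegrable (fun t => u t i) volume 0 tf := fun i => by
      rw [intervalIntegrable_iff_integrableOn_Ioo_of_le htf.le]
      exact hu1.eval i
    simp only [hy, dotProduct]
    rw [← Finset.sum_fn]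
    refine IntervalIntegrable.sum _ fun i _ => (hui i).continuousOn_mul ?_
    have hc : Continuous fun v : n → ℝ => ((-(Bᵀ * K)) *ᵥ v) i := by fun_prop
    exact hc.comp_continuousOn hw.continuousOn
  refine ⟨hint, ?_⟩
  have hq := hw.quadraticForm K
  -- The integrand on the left is `V'`; it differs from `yᵀ u` by the dissipated power `(K E x)ᵀ E
  -- (K E x) ≥ 0`.
  have hpos : ∫ t in (0 : ℝ)..tf, -(1 / 2) * deriv (fun τ => (E *ᵥ x τ) ⬝ᵥ (K *ᵥ (E *ᵥ x τ))) t ≤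
      ∫ t in (0 : ℝ)..tf, ((-(Bᵀ * G * A)) *ᵥ x t) ⬝ᵥ u t := by
    refine intervalIntegral.integral_mono_ae_restrict htf.le
      (hq.intervalIntegrable_deriv.const_mul _) hint ?_
    rw [← restrict_Ioo_eq_restrict_Icc]
    filter_upwards [hx.equation] with t ht
    rw [(hasDerivAt_quadraticForm hGAG ht).deriv, hy]
    have h1 := hE.dotProduct_mulVec_nonneg (K *ᵥ (E *ᵥ x t))
    have h2 : (K *ᵥ (E *ᵥ x t)) ⬝ᵥ (A *ᵥ x t) =
        (K *ᵥ (E *ᵥ x t)) ⬝ᵥ (E *ᵥ (K *ᵥ (E *ᵥ x t))) := by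
      have h3 : ∀ a b : n → ℝ, (K *ᵥ a) ⬝ᵥ b = a ⬝ᵥ (K *ᵥ b) := fun a b => by
        rw [dotProduct_mulVec, ← mulVec_transpose, hGAG]
      rw [h3, h3]
      simp only [mulVec_mulVec]
      rw [hKA]
      simp only [Matrix.mul_assoc]
    have h4 : ((-(Bᵀ * K)) *ᵥ (E *ᵥ x t)) ⬝ᵥ u t = -((K *ᵥ (E *ᵥ x t)) ⬝ᵥ (B *ᵥ u t)) := by
      rw [neg_mulVec, neg_dotProduct, ← mulVec_mulVec, mulVec_transpose, dotProduct_mulVec]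
    rw [star_trivial] at h1
    rw [h4, dotProduct_add, h2]
    linarith
  refine le_trans ?_ hpos
  rw [intervalIntegral.integral_const_mul, hq.integral_deriv_eq_sub]
  have h5 := hA.dotProduct_mulVec_nonneg (G *ᵥ (E *ᵥ x tf))
  have h6 : (E *ᵥ x tf) ⬝ᵥ (K *ᵥ (E *ᵥ x tf)) =
      (G *ᵥ (E *ᵥ x tf)) ⬝ᵥ (A *ᵥ (G *ᵥ (E *ᵥ x tf))) := by
    rw [hK, ← mulVec_mulVec, ← mulVec_mulVec, dotProduct_mulVec, ← mulVec_transpose,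
      hG.transpose_eq]
  rw [star_trivial, neg_mulVec, dotProduct_neg] at h5
  rw [h6, hx0]
  simp only [mulVec_zero, dotProduct_zero]
  linarith

end Passivity

/-! ### Regularity of the pencil and positive realness. -/

section PositiveReal

open Matrix
open scoped ComplexOrder MatrixOrder

variable {n m : Type*} [Fintype n] [Fintype m]

theorem map_ofReal_mul {a b c : Type*} [Fintype b] (P : Matrix a b ℝ) (Q : Matrix b c ℝ) :
    (P * Q).map Complex.ofReal = P.map Complex.ofReal * Q.map Complex.ofReal :=
  Matrix.map_mul (f := Complex.ofRealHom)

theorem conjTranspose_map_ofReal {a b : Type*} (P : Matrix a b ℝ) :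
    (P.map Complex.ofReal)ᴴ = Pᵀ.map Complex.ofReal := by
  ext
  simp

theorem _root_.Matrix.PosSemidef.map_ofReal {P : Matrix n n ℝ} (hP : P.PosSemidef) :
    (P.map Complex.ofReal).PosSemidef := by
  classical
  obtain ⟨Q, rfl⟩ := CStarAlgebra.nonneg_iff_eq_star_mul_self.mp hP.nonneg
  rw [star_eq_conjTranspose]
  have : (Qᴴ * Q).map Complex.ofReal = (Q.map Complex.ofReal)ᴴ * Q.map Complex.ofReal := by
    ext i j
    simp [Matrix.mul_apply]
  rw [this]
  exact posSemidef_conjTranspose_mul_self _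

theorem _root_.Matrix.PosDef.map_ofReal {P : Matrix n n ℝ} (hP : P.PosDef) :
    (P.map Complex.ofReal).PosDef := by
  classical
  rw [hP.posSemidef.map_ofReal.posDef_iff_isUnit]
  exact hP.isUnit.map (Complex.ofRealHom.mapMatrix)

theorem posDef_add_of_ker_inter_eq_zero {P Q : Matrix n n ℝ} (hP : P.PosSemidef)
    (hQ : Q.PosSemidef) (h : ∀ v, P *ᵥ v = 0 → Q *ᵥ v = 0 → v = 0) : (P + Q).PosDef := by
  refine .of_dotProduct_mulVec_pos (hP.add hQ).isHermitian fun v hv => ?_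
  have h1 := hP.dotProduct_mulVec_nonneg v
  have h2 := hQ.dotProduct_mulVec_nonneg v
  refine lt_of_le_of_ne ((hP.add hQ).dotProduct_mulVec_nonneg v) fun h0 => hv (h v ?_ ?_)
  · rw [← hP.dotProduct_mulVec_zero_iff]
    rw [add_mulVec, dotProduct_add] at h0
    linarith
  · rw [← hQ.dotProduct_mulVec_zero_iff]
    rw [add_mulVec, dotProduct_add] at h0
    linarith

/-- For a null vector `v` of the pencil, the real part of `v* (p E - A) v` is `Re p · v* E v + v*
(-A) v`. Both terms are nonnegative, so both vanish, contradicting definiteness of `E - A`. -/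
theorem isUnit_det_pencil [DecidableEq n] {E A : Matrix n n ℝ} (hE : E.PosSemidef)
    (hA : (-A).PosSemidef) (hEA : (E + -A).PosDef) {p : ℂ} (hp : 0 < p.re) :
    IsUnit (pencil E A p).det := by
  rw [isUnit_iff_ne_zero]
  intro h0
  obtain ⟨v, hv, hv0⟩ := exists_mulVec_eq_zero_iff.mpr h0
  have hadd : (E + -A).map Complex.ofReal = E.map Complex.ofReal + (-A).map Complex.ofReal := by
    ext; simp
  have h1 := hE.map_ofReal.dotProduct_mulVec_nonneg v
  have h2 := hA.map_ofReal.dotProduct_mulVec_nonneg v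
  have h3 := hEA.map_ofReal.dotProduct_mulVec_pos hv
  have h4 : star v ⬝ᵥ (pencil E A p *ᵥ v) = 0 := by rw [hv0, dotProduct_zero]
  have hpen : pencil E A p = p • E.map Complex.ofReal + (-A).map Complex.ofReal := by
    ext; simp [pencil, sub_eq_add_neg]
  rw [hpen, add_mulVec, dotProduct_add, smul_mulVec, dotProduct_smul, smul_eq_mul] at h4
  rw [hadd, add_mulVec, dotProduct_add] at h3
  rw [Complex.le_def] at h1 h2
  rw [Complex.lt_def] at h3
  have h5 := congrArg Complex.re h4
  simp only [Complex.add_re, Complex.mul_re, Complex.zero_re, Complex.zero_im] at *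
  rw [← h1.2] at h5
  nlinarith [mul_nonneg hp.le h1.1]

/-- By Cramer's rule the entries of the inverse are polynomials in `p` divided by a nonvanishing
determinant; complex differentiability on an open set gives analyticity. -/
theorem analyticOnNhd_transferFunction {m : Type*} [DecidableEq n] {E A : Matrix n n ℝ}
    (h : ∀ p : ℂ, 0 < p.re → IsUnit (pencil E A p).det) (B : Matrix n m ℝ) (C : Matrix m n ℝ)
    (i j : m) : AnalyticOnNhd ℂ (fun p => transferFunction E A B C p i j) {p : ℂ | 0 < p.re} := by
  have hdet : ∀ M : ℂ → Matrix n n ℂ, (∀ a b, Differentiable ℂ fun p => M p a b) →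
      Differentiable ℂ fun p => (M p).det := fun M hM => by
    simp only [det_apply']
    fun_prop
  have hent : ∀ a b, Differentiable ℂ fun p => pencil E A p a b := fun a b => by
    simp only [pencil, Matrix.sub_apply, Matrix.smul_apply, smul_eq_mul]
    fun_prop
  have hadj : ∀ a b, Differentiable ℂ fun p => (pencil E A p).adjugate a b := fun a b => by
    simp only [adjugate_apply]
    refine hdet _ fun c d => ?_
    simp only [updateRow_apply]
    split_ifs
    · fun_prop
    · exact hent c d
  have hinv : ∀ a b, DifferentiableOn ℂ (fun p => (pencil E A p)⁻¹ a b) {p : ℂ | 0 < p.re} := by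
    intro a b
    simp only [inv_def, Ring.inverse_eq_inv', Matrix.smul_apply, smul_eq_mul]
    exact ((hdet _ hent).differentiableOn.inv fun p hp => (h p hp).ne_zero).mul
      (hadj a b).differentiableOn
  refine DifferentiableOn.analyticOnNhd ?_ (isOpen_lt continuous_const Complex.continuous_re)
  simp only [transferFunction, mul_apply]
  exact .fun_sum fun b _ => (DifferentiableOn.fun_sum fun a _ =>
    (hinv a b).const_mul _).mul_const _

theorem IsCompatibleInverse.isPositiveReal [DecidableEq n] {E A G : Matrix n n ℝ}
    (hG : IsCompatibleInverse E A G) (hE : E.PosSemidef) (hA : (-A).PosSemidef)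
    (hreg : ∀ p : ℂ, 0 < p.re → IsUnit (pencil E A p).det) (B : Matrix n m ℝ) :
    IsPositiveReal (transferFunction E A B (-(Bᵀ * G * A))) := by
  refine ⟨analyticOnNhd_transferFunction hreg _ _, fun p hp => ?_⟩
  have hEt : Eᵀ = E := by
    simpa [IsHermitian, conjTranspose_eq_transpose_of_trivial] using hE.isHermitian
  have hAt : Aᵀ = A := by
    simpa [IsHermitian, conjTranspose_eq_transpose_of_trivial] using hA.isHermitian
  have hQ : (-(E * G * A)).PosSemidef := by
    have h := hA.mul_mul_conjTranspose_same (E * G)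
    have h1 : E * G * -A * (E * G)ᴴ = -(E * G * A) := by
      rw [conjTranspose_eq_transpose_of_trivial, transpose_mul, hEt, hG.transpose_eq]
      calc _ = -(E * G * (A * G * E)) := by simp [Matrix.mul_assoc]
        _ = -(E * (G * E * G) * A) := by rw [hG.mul_mul_comm]; simp only [Matrix.mul_assoc]
        _ = _ := by rw [hG.mul_mul_self]
    rwa [h1] at h
  have hAGA : (A * G * A).PosSemidef := by
    have h := hE.mul_mul_conjTranspose_same (A * G)
    have h1 : A * G * E * (A * G)ᴴ = A * G * A := by
      rw [conjTranspose_eq_transpose_of_trivial, transpose_mul, hAt, hG.transpose_eq]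
      calc _ = A * (G * E * G) * A := by simp only [Matrix.mul_assoc]
        _ = _ := by rw [hG.mul_mul_self]
    rwa [h1] at h
  set N := (pencil E A p)⁻¹ * B.map Complex.ofReal with hN
  have hBN : pencil E A p * N = B.map Complex.ofReal :=
    mul_nonsing_inv_cancel_left _ _ (hreg p hp)
  have hpen : (pencil E A p)ᴴ = star p • E.map Complex.ofReal - A.map Complex.ofReal := by
    rw [pencil, conjTranspose_sub, conjTranspose_smul, conjTranspose_map_ofReal,
      conjTranspose_map_ofReal, hEt, hAt]
  -- Substituting `Bᵀ = Nᴴ (p̄ E - A)`, the adjoint of `B = (p E - A) N`, produces the congruence by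
  -- `N`.
  have hH : transferFunction E A B (-(Bᵀ * G * A)) p =
      Nᴴ * (star p • (-(E * G * A)).map Complex.ofReal + (A * G * A).map Complex.ofReal) * N := by
    have h1 : (-(Bᵀ * G * A)).map Complex.ofReal =
        -(Bᵀ.map Complex.ofReal * (G * A).map Complex.ofReal) := by
      rw [← map_ofReal_mul, ← Matrix.mul_assoc]; ext; simp
    have h2 : (-(E * G * A)).map Complex.ofReal =
        -(E.map Complex.ofReal * (G * A).map Complex.ofReal) := by
      rw [← map_ofReal_mul, ← Matrix.mul_assoc]; ext; simp
    rw [transferFunction, h1, h2, Matrix.mul_assoc A, map_ofReal_mul A, ← conjTranspose_map_ofReal B,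
      ← hBN, conjTranspose_mul, hpen, Matrix.mul_assoc (-_), hBN, ← hN]
    simp only [Matrix.mul_assoc, Matrix.sub_mul, Matrix.mul_sub, Matrix.mul_add, Matrix.add_mul,
      Matrix.smul_mul, Matrix.mul_smul, Matrix.neg_mul, Matrix.mul_neg, smul_neg]
    abel
  have hsum : transferFunction E A B (-(Bᵀ * G * A)) p +
      (transferFunction E A B (-(Bᵀ * G * A)) p)ᴴ =
      Nᴴ * ((2 * p.re : ℝ) • (-(E * G * A)).map Complex.ofReal +
        (2 : ℝ) • (A * G * A).map Complex.ofReal) * N := by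
    rw [hH]
    simp only [conjTranspose_mul, conjTranspose_add, conjTranspose_smul, conjTranspose_conjTranspose,
      hQ.map_ofReal.isHermitian.eq, hAGA.map_ofReal.isHermitian.eq, star_star]
    rw [← Matrix.mul_assoc Nᴴ _ N, ← Matrix.add_mul, ← Matrix.mul_add]
    congr 2
    have h1 : (2 * p.re : ℝ) • (-(E * G * A)).map Complex.ofReal =
        (star p + p) • (-(E * G * A)).map Complex.ofReal := by
      ext i j
      have : (star p + p : ℂ) = ((2 * p.re : ℝ) : ℂ) := by
        rw [add_comm]; exact Complex.add_conj p
      rw [this]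
      simp
    rw [h1, add_smul, two_smul]
    abel
  rw [hsum]
  exact ((hQ.map_ofReal.smul (by positivity)).add
    (hAGA.map_ofReal.smul (by norm_num))).conjTranspose_mul_mul_same N

end PositiveReal

end MQS

namespace MQS

/-! ### Definiteness and trivial kernel intersection for the MQS matrices. -/

section System

open Matrix

variable {n₁ n₂ f m r : Type*} [Fintype n₁] [DecidableEq n₁]

theorem Data.posDef_Mσ [Fintype m] [DecidableEq m] {D : Data n₁ n₂ f m r}
    (hM₁₁ : D.M₁₁.PosDef) (hR : D.R.PosDef) :
    D.Mσ.PosDef := by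
  have := hM₁₁.isUnit.invertible
  have hpsd : D.Mσ.PosSemidef := by
    have := (PosDef.fromBlocks₁₁ (0 : Matrix n₁ m ℝ) D.R⁻¹ hM₁₁).mpr
      (by simpa using hR.inv.posSemidef)
    simpa [Data.Mσ] using this
  rw [hpsd.posDef_iff_isUnit, isUnit_iff_isUnit_det, Data.Mσ, det_fromBlocks_zero₂₁]
  exact ((isUnit_iff_isUnit_det _).mp hM₁₁.isUnit).mul
    ((isUnit_iff_isUnit_det _).mp hR.inv.isUnit)

/-- The identity block of `F_σ` kills the first component. For the second, `v₂`, the vector `Y v₂`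
lies in `im C₂ᵀ` and in `ker C₂`, which are orthogonal, so it vanishes, and `Y` is injective. -/
theorem Data.eq_zero_of_transpose_mulVec_eq_zero [Fintype n₂] [Fintype f] [Fintype r]
    {D : Data n₁ n₂ f m r}
    (hY : IsBasisMatrix D.Y (matIm D.C₂ᵀ)) {v : n₁ ⊕ r → ℝ} (hσ : D.Fσᵀ *ᵥ v = 0)
    (hν : D.Fνᵀ *ᵥ v = 0) : v = 0 := by
  have hv : v = Sum.elim (v ∘ Sum.inl) (v ∘ Sum.inr) := (Sum.elim_comp_inl_inr v).symm
  have h1 : v ∘ Sum.inl = 0 := by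
    rw [Data.Fσ, fromBlocks_transpose, fromBlocks_mulVec] at hσ
    have := congrArg (fun g => g ∘ Sum.inl) hσ
    simpa using this
  have h2 : D.C₂ *ᵥ (D.Y *ᵥ (v ∘ Sum.inr)) = 0 := by
    rw [Data.Fν, transpose_fromRows, hv, fromCols_mulVec_sumElim, h1] at hν
    simpa [transpose_mul, mulVec_mulVec] using hν
  obtain ⟨g, hg⟩ : ∃ g, D.C₂ᵀ *ᵥ g = D.Y *ᵥ (v ∘ Sum.inr) := by
    have : D.Y *ᵥ (v ∘ Sum.inr) ∈ matIm D.C₂ᵀ := hY.mem_iff.mpr ⟨_, rfl⟩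
    exact this
  have h3 : v ∘ Sum.inr = 0 := by
    refine hY.mulVec_eq_zero (dotProduct_self_eq_zero.mp ?_)
    nth_rewrite 1 [← hg]
    rw [mulVec_transpose, ← dotProduct_mulVec, h2, dotProduct_zero]
  rw [hv, h1, h3]
  ext (i | i) <;> rfl

end System

end MQS

theorem mainTheorem3
    {n₁ n₂ f m r s z q : Type*}
    [Fintype n₁] [Fintype n₂] [Fintype f] [Fintype m] [Fintype r]
    [Fintype s] [Fintype z] [Fintype q]
    [DecidableEq n₁] [DecidableEq m] [DecidableEq r]
    [DecidableEq s] [DecidableEq z] [DecidableEq q]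
    (D : MQS.Data n₁ n₂ f m r)
    (hM₁₁ : D.M₁₁.PosDef) (hR : D.R.PosDef) (hMν : D.Mν.PosDef)
    (hY : MQS.IsBasisMatrix D.Y (MQS.matIm D.C₂.transpose))
    (Yσ : Matrix (n₁ ⊕ r) q ℝ) (hYσ : MQS.IsBasisMatrix Yσ (MQS.matKer D.Fσ.transpose))
    (Yν : Matrix (n₁ ⊕ r) z ℝ) (hYν : MQS.IsBasisMatrix Yν (MQS.matKer D.Fν.transpose))
    (W₁ : Matrix (n₁ ⊕ r) s ℝ)
    (hW₁ : MQS.IsBasisMatrix W₁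
      (MQS.matKer (Matrix.fromCols (D.Er * Yν) (D.Ar * Yσ)).transpose)) :
    MQS.IsPassive D.Er D.Ar D.Br (D.Cr W₁ Yν Yσ) ∧
    (∀ p : ℂ, 0 < p.re → IsUnit (MQS.pencil D.Er D.Ar p).det) ∧
    MQS.IsPositiveReal (MQS.transferFunction D.Er D.Ar D.Br (D.Cr W₁ Yν Yσ)) := by
  have hMσ := MQS.Data.posDef_Mσ hM₁₁ hR
  have hE : D.Er.PosSemidef := by
    simpa [MQS.Data.Er, Matrix.conjTranspose_eq_transpose_of_trivial] using
      hMσ.posSemidef.mul_mul_conjTranspose_same D.Fσ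
  have hA : (-D.Ar).PosSemidef := by
    simpa [MQS.Data.Ar, Matrix.conjTranspose_eq_transpose_of_trivial] using
      hMν.posSemidef.mul_mul_conjTranspose_same D.Fν
  have hkE : MQS.matKer D.Er = MQS.matKer D.Fσ.transpose := MQS.matKer_mul_mul_transpose hMσ
  have hkA : MQS.matKer D.Ar = MQS.matKer D.Fν.transpose := by
    rw [← MQS.matKer_mul_mul_transpose hMν]
    ext v
    simp [MQS.mem_matKer, MQS.Data.Ar, Matrix.neg_mulVec]
  have hEA : ∀ v, D.Er.mulVec v = 0 → D.Ar.mulVec v = 0 → v = 0 := fun v h1 h2 => by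
    rw [← MQS.mem_matKer, hkE, MQS.mem_matKer] at h1
    rw [← MQS.mem_matKer, hkA, MQS.mem_matKer] at h2
    exact MQS.Data.eq_zero_of_transpose_mulVec_eq_zero hY h1 h2
  have hG := MQS.isCompatibleInverse_reflexiveInverse hE hA hEA (hkE ▸ hYσ) (hkA ▸ hYν) hW₁
  have hpd := MQS.posDef_add_of_ker_inter_eq_zero hE hA fun v h1 h2 =>
    hEA v h1 (by simpa [Matrix.neg_mulVec] using h2)
  have hreg := fun (p : ℂ) (hp : 0 < p.re) => MQS.isUnit_det_pencil hE hA hpd hp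
  exact ⟨hG.isPassive hE hA _, hreg, hG.isPositiveReal hE hA hreg _⟩
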